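/- Let $\theta\in\mathbb R$ and let $\mathcal A$ be the rotation algebra, i.e. the $C^*$-algebra generated by the unitaries $U e_{k,l}=e^{i\theta l/2}e_{k+1,l}$ and $V e_{k,l}=e^{-i\theta k/2}e_{k,l+1}$ on $\ell^2(\mathbb Z^2)$, which satisfy $UV=e^{i\theta}VU$. Let $\hat\theta$ be the gauge action of $\mathbb R^2$ on $\mathcal A$ by $*$-automorphisms, determined by $$\hat\theta_{s,t}(U^kV^l)=e^{-i(sk+tl)}U^kV^l\qquad(s,t\in\mathbb R,\ k,l\in\mathbb Z).$$ Call $W\in\mathcal A$ a differential basis if $W$ is not self-adjoint and $W$ commutes with $W^*$. For $W\in\mathcal A$ define the first order form of $a\in\mathcal A$ by $$\delta_W a=[W,a]\,dW+[W^*,a]\,dW^*,\qquad [x,a]=xa-ax,$$ where $dW,dW^*$ are formal symbols forming the basis of the free left $\mathcal A$-module $\mathcal A\oplus\mathcal A$. **Theorem.** Let $k_1,k_2\in\mathbb Z$. If $(k_1,k_2)\neq(0,0)$, then $U^{k_1}V^{k_2}$ is a differential basis. For all $k_1,k_2\in\mathbb Z$ and every $a\in\mathcal A$, $$\delta_{U^{k_1}V^{k_2}}a=U^{k_1}V^{k_2}\bigl(a-\hat\theta_{-k_2\theta,\,k_1\theta}(a)\bigr)\,d\bigl(U^{k_1}V^{k_2}\bigr)+\bigl(U^{k_1}V^{k_2}\bigr)^*\bigl(a-\hat\theta_{k_2\theta,\,-k_1\theta}(a)\bigr)\,d\bigl(U^{k_1}V^{k_2}\bigr)^*.$$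 -/

import Mathlib

open scoped ENNReal

noncomputable section

/-! ### The first order differential calculus of a differential basis -/

namespace InnerCalculus

variable {A : Type*} [CStarAlgebra A] {n : ℕ}

/-- `U₁, …, Uₙ` is a differential basis: each `Uⱼ` is non self-adjoint, and
`U₁, U₁*, …, Uₙ, Uₙ*` mutually commute. -/
structure IsDifferentialBasis (U : Fin n → A) : Prop where
  not_isSelfAdjoint : ∀ j, ¬ IsSelfAdjoint (U j)
  commute : ∀ j k, Commute (U j) (U k)
  commute_star : ∀ j k, Commute (U j) (star (U k))
  commute_star_star : ∀ j k, Commute (star (U j)) (star (U k))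

variable (A n) in
/-- One-forms: the direct sum of `2n` copies of `A`, as a left `A`-module. The index `Sum.inl j`
is the copy belonging to the symbol `dUⱼ`, and `Sum.inr j` the one belonging to `dUⱼ*`. -/
abbrev OneForm : Type _ := Fin n ⊕ Fin n → A

variable (A) in
/-- The basis symbol `dUⱼ`. -/
def d (j : Fin n) : OneForm A n := Pi.single (Sum.inl j) 1

variable (A) in
/-- The basis symbol `dUⱼ*`. -/
def dStar (j : Fin n) : OneForm A n := Pi.single (Sum.inr j) 1

/-- The first order form `δ a = ∑ⱼ [Uⱼ, a] dUⱼ + ∑ⱼ [Uⱼ*, a] dUⱼ*`,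
where `[x, a] = x a - a x`. -/
def delta (U : Fin n → A) (a : A) : OneForm A n :=
  ∑ j, (U j * a - a * U j) • d A j + ∑ j, (star (U j) * a - a * star (U j)) • dStar A j

end InnerCalculus

/-! ### The rotation algebra -/

namespace RotationAlgebra

/-- The Hilbert space `ℓ²(ℤ²)`. -/
abbrev H : Type := lp (fun _ : ℤ × ℤ => ℂ) 2

/-- Auxiliary: a translate of an `ℓ²` family multiplied by phases is an `ℓ²` family. -/
theorem memlp_shift (c : ℤ × ℤ) (w : ℤ × ℤ → Circle) (f : H) :
    Memℓp (fun p => (w p : ℂ) * f (p - c)) 2 := by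
  have h2 : (0 : ℝ) < (2 : ℝ≥0∞).toReal := by norm_num
  rw [memℓp_gen_iff h2]
  have := (Equiv.subRight c).summable_iff.mpr ((lp.memℓp f).summable h2)
  refine this.congr fun p => ?_
  simp [Circle.norm_coe]

/-- The operator `(T f)(p) = w(p) f(p - c)` on `ℓ²(ℤ²)`, i.e. the weighted translation
`T e_p = w(p + c) e_{p + c}`. -/
def weightedShift (c : ℤ × ℤ) (w : ℤ × ℤ → Circle) : H ≃ₗᵢ[ℂ] H where
  toFun f := ⟨fun p => (w p : ℂ) * f (p - c), memlp_shift c w f⟩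
  map_add' f g := by
    refine lp.ext (funext fun p => ?_)
    exact mul_add (w p : ℂ) (f (p - c)) (g (p - c))
  map_smul' r f := by
    ext p
    simp [mul_left_comm]
  invFun f := ⟨fun p => (((w (p + c))⁻¹ : Circle) : ℂ) * f (p + c), by
    have h := memlp_shift (-c) (fun p => (w (p + c))⁻¹) f
    simp only [sub_neg_eq_add] at h
    exact h⟩
  left_inv f := by
    ext p
    simp
  right_inv f := by
    ext p
    simp
  norm_map' f := by
    have h2 : (0 : ℝ) < (2 : ℝ≥0∞).toReal := by norm_num
    rw [lp.norm_eq_tsum_rpow h2, lp.norm_eq_tsum_rpow h2]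
    congr 1
    rw [← (Equiv.subRight c).tsum_eq (fun p => ‖f p‖ ^ (2 : ℝ≥0∞).toReal)]
    refine tsum_congr fun p => ?_
    simp [Circle.norm_coe]

theorem weightedShift_apply (c : ℤ × ℤ) (w : ℤ × ℤ → Circle) (f : H) (p : ℤ × ℤ) :
    weightedShift c w f p = (w p : ℂ) * f (p - c) := rfl

/-- The weighted translation as a unitary element of `B(ℓ²(ℤ²))`. -/
def unitaryShift (c : ℤ × ℤ) (w : ℤ × ℤ → Circle) : unitary (H →L[ℂ] H) :=
  Unitary.linearIsometryEquiv.symm (weightedShift c w)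

theorem unitaryShift_apply (c : ℤ × ℤ) (w : ℤ × ℤ → Circle) (f : H) (p : ℤ × ℤ) :
    (unitaryShift c w : H →L[ℂ] H) f p = (w p : ℂ) * f (p - c) := rfl

/-- The unitary operator `U e_{k,l} = exp(i θ l / 2) e_{k+1,l}`. -/
def opU (θ : ℝ) : unitary (H →L[ℂ] H) :=
  unitaryShift (1, 0) fun p => Circle.exp (θ * p.2 / 2)

/-- The unitary operator `V e_{k,l} = exp(-i θ k / 2) e_{k,l+1}`. -/
def opV (θ : ℝ) : unitary (H →L[ℂ] H) :=
  unitaryShift (0, 1) fun p => Circle.exp (-(θ * p.1 / 2))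

/-- The relation `U V = exp(i θ) V U`. -/
theorem opU_mul_opV (θ : ℝ) :
    (opU θ * opV θ : H →L[ℂ] H) = (Circle.exp θ : ℂ) • (opV θ * opU θ : H →L[ℂ] H) := by
  refine ContinuousLinearMap.ext fun f => lp.ext (funext fun p => ?_)
  simp only [mul_apply_eq_comp, smul_apply, lp.coeFn_smul, Pi.smul_apply,
    opU, opV, unitaryShift_apply, smul_eq_mul]
  rw [show p - (1, 0) - (0, 1) = p - (0, 1) - (1, 0) by abel]
  simp only [← mul_assoc, ← Circle.coe_mul, ← Circle.exp_add]
  congr 3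
  simp
  ring

/-- The rotation algebra: the `C*`-algebra of operators on `ℓ²(ℤ²)` generated by `U` and `V`. -/
def algebra (θ : ℝ) : StarSubalgebra ℂ (H →L[ℂ] H) :=
  (StarAlgebra.adjoin ℂ {(opU θ : H →L[ℂ] H), (opV θ : H →L[ℂ] H)}).topologicalClosure

instance isClosed_algebra (θ : ℝ) : IsClosed (algebra θ : Set (H →L[ℂ] H)) :=
  StarSubalgebra.isClosed_topologicalClosure _

theorem opU_mem (θ : ℝ) : (opU θ : H →L[ℂ] H) ∈ algebra θ :=
  StarSubalgebra.le_topologicalClosure _ (StarAlgebra.subset_adjoin _ _ (by simp))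

theorem opV_mem (θ : ℝ) : (opV θ : H →L[ℂ] H) ∈ algebra θ :=
  StarSubalgebra.le_topologicalClosure _ (StarAlgebra.subset_adjoin _ _ (by simp))

/-- The generator `U` as a unitary element of the rotation algebra. -/
def U (θ : ℝ) : unitary (algebra θ) :=
  ⟨⟨opU θ, opU_mem θ⟩, by
    rw [Unitary.mem_iff]
    exact ⟨Subtype.ext (Unitary.coe_star_mul_self (opU θ)),
      Subtype.ext (Unitary.coe_mul_star_self (opU θ))⟩⟩

/-- The generator `V` as a unitary element of the rotation algebra. -/
def V (θ : ℝ) : unitary (algebra θ) :=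
  ⟨⟨opV θ, opV_mem θ⟩, by
    rw [Unitary.mem_iff]
    exact ⟨Subtype.ext (Unitary.coe_star_mul_self (opV θ)),
      Subtype.ext (Unitary.coe_mul_star_self (opV θ))⟩⟩

/-- `U^k V^l` for integers `k, l`. -/
def monomial (θ : ℝ) (k l : ℤ) : algebra θ := ((U θ ^ k * V θ ^ l : unitary (algebra θ)) : algebra θ)

theorem U_mul_V (θ : ℝ) :
    (U θ * V θ : algebra θ) = (Circle.exp θ : ℂ) • (V θ * U θ : algebra θ) :=
  Subtype.ext (opU_mul_opV θ)

/-! ### The gauge action of `ℝ²` -/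

/-- The diagonal unitary `D_{s,t} e_{k,l} = exp(-i (s k + t l)) e_{k,l}`. -/
def opD (s t : ℝ) : unitary (H →L[ℂ] H) :=
  unitaryShift 0 fun p => Circle.exp (-(s * p.1 + t * p.2))

theorem opD_add (s t s' t' : ℝ) : opD (s + s') (t + t') = opD s t * opD s' t' := by
  refine Subtype.ext (ContinuousLinearMap.ext fun f => lp.ext (funext fun p => ?_))
  simp only [Submonoid.coe_mul, mul_apply_eq_comp, opD, unitaryShift_apply,
    ← mul_assoc, ← Circle.coe_mul, ← Circle.exp_add, sub_zero]
  congr 3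
  ring

theorem opD_zero : opD 0 0 = 1 := by
  have h := opD_add 0 0 0 0
  rw [add_zero] at h
  exact left_eq_mul.mp h

/-- Conjugation by `D_{s,t}`, as an automorphism of `B(ℓ²(ℤ²))`. -/
abbrev conjD (s t : ℝ) : (H →L[ℂ] H) ≃⋆ₐ[ℂ] (H →L[ℂ] H) :=
  Unitary.conjStarAlgAut ℂ (H →L[ℂ] H) (opD s t)

theorem conjD_opU (θ s t : ℝ) :
    conjD s t (opU θ : H →L[ℂ] H) = (Circle.exp (-s) : ℂ) • (opU θ : H →L[ℂ] H) := by
  have h : (opD s t * opU θ : H →L[ℂ] H) = (Circle.exp (-s) : ℂ) • (opU θ * opD s t : H →L[ℂ] H) := by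
    refine ContinuousLinearMap.ext fun f => lp.ext (funext fun p => ?_)
    simp only [mul_apply_eq_comp, smul_apply, lp.coeFn_smul, Pi.smul_apply,
      opU, opD, unitaryShift_apply, smul_eq_mul, sub_zero]
    simp only [← mul_assoc, ← Circle.coe_mul, ← Circle.exp_add]
    congr 3
    simp
    ring
  rw [Unitary.conjStarAlgAut_apply, h, smul_mul_assoc, mul_assoc, ← Unitary.coe_star,
    ← Submonoid.coe_mul, Unitary.mul_star_self]
  simp

theorem conjD_opV (θ s t : ℝ) :
    conjD s t (opV θ : H →L[ℂ] H) = (Circle.exp (-t) : ℂ) • (opV θ : H →L[ℂ] H) := by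
  have h : (opD s t * opV θ : H →L[ℂ] H) = (Circle.exp (-t) : ℂ) • (opV θ * opD s t : H →L[ℂ] H) := by
    refine ContinuousLinearMap.ext fun f => lp.ext (funext fun p => ?_)
    simp only [mul_apply_eq_comp, smul_apply, lp.coeFn_smul, Pi.smul_apply,
      opV, opD, unitaryShift_apply, smul_eq_mul, sub_zero]
    simp only [← mul_assoc, ← Circle.coe_mul, ← Circle.exp_add]
    congr 3
    simp
    ring
  rw [Unitary.conjStarAlgAut_apply, h, smul_mul_assoc, mul_assoc, ← Unitary.coe_star,
    ← Submonoid.coe_mul, Unitary.mul_star_self]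
  simp

theorem conjD_mem (θ s t : ℝ) {a : H →L[ℂ] H} (ha : a ∈ algebra θ) : conjD s t a ∈ algebra θ := by
  let φ : (H →L[ℂ] H) →⋆ₐ[ℂ] (H →L[ℂ] H) := (conjD s t : (H →L[ℂ] H) →⋆ₐ[ℂ] (H →L[ℂ] H))
  have hφ : Continuous φ := by
    change Continuous fun x : H →L[ℂ] H =>
      (opD s t : H →L[ℂ] H) * x * (star (opD s t : H →L[ℂ] H))
    fun_prop
  have hle : algebra θ ≤ (algebra θ).comap φ := by
    refine StarSubalgebra.topologicalClosure_minimal ?_ ((isClosed_algebra θ).preimage hφ)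
    rw [StarAlgebra.adjoin_le_iff]
    rintro x (rfl | rfl)
    · change conjD s t (opU θ : H →L[ℂ] H) ∈ algebra θ
      rw [conjD_opU]
      exact SMulMemClass.smul_mem _ (opU_mem θ)
    · change conjD s t (opV θ : H →L[ℂ] H) ∈ algebra θ
      rw [conjD_opV]
      exact SMulMemClass.smul_mem _ (opV_mem θ)
  exact hle ha

theorem conjD_conjD (s t s' t' : ℝ) (a : H →L[ℂ] H) :
    conjD s t (conjD s' t' a) = conjD (s + s') (t + t') a := by
  rw [conjD, conjD, conjD, ← Unitary.conjStarAlgAut_mul_apply, opD_add]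

theorem conjD_zero (a : H →L[ℂ] H) : conjD 0 0 a = a := by
  rw [conjD, opD_zero, map_one]
  rfl

/-- The gauge automorphism `θ̂_{s,t}` of the rotation algebra. It is determined by
`θ̂_{s,t}(U^k V^l) = exp(-i (s k + t l)) U^k V^l`, see `gauge_monomial`. -/
def gauge (θ s t : ℝ) : algebra θ ≃⋆ₐ[ℂ] algebra θ where
  toFun a := ⟨conjD s t a, conjD_mem θ s t a.2⟩
  invFun a := ⟨conjD (-s) (-t) a, conjD_mem θ (-s) (-t) a.2⟩
  left_inv a := Subtype.ext <| by simp only [conjD_conjD, neg_add_cancel, conjD_zero]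
  right_inv a := Subtype.ext <| by simp only [conjD_conjD, add_neg_cancel, conjD_zero]
  map_mul' a b := Subtype.ext <| map_mul (conjD s t) (a : H →L[ℂ] H) b
  map_add' a b := Subtype.ext <| map_add (conjD s t) (a : H →L[ℂ] H) b
  map_star' a := Subtype.ext <| map_star (conjD s t) (a : H →L[ℂ] H)
  map_smul' r a := Subtype.ext <| map_smul (conjD s t) r (a : H →L[ℂ] H)

theorem gauge_zero (θ : ℝ) (a : algebra θ) : gauge θ 0 0 a = a :=
  Subtype.ext (conjD_zero _)

theorem gauge_add (θ s t s' t' : ℝ) (a : algebra θ) :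
    gauge θ (s + s') (t + t') a = gauge θ s t (gauge θ s' t' a) :=
  Subtype.ext (conjD_conjD s t s' t' _).symm

/-- Auxiliary: an automorphism that scales a unitary by a phase scales its powers accordingly. -/
theorem map_zpow_of_phase {A : Type*} [CStarAlgebra A] (φ : A ≃⋆ₐ[ℂ] A) (u : unitary (A)) (x : ℝ)
    (h : φ (u : A) = (Circle.exp x : ℂ) • (u : A)) (k : ℤ) :
    φ ((u ^ k : unitary (A)) : A) =
      (Circle.exp (k * x) : ℂ) • ((u ^ k : unitary (A)) : A) := by
  have hn : ∀ m : ℕ, φ ((u ^ m : unitary (A)) : A) =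
      (Circle.exp (m * x) : ℂ) • ((u ^ m : unitary (A)) : A) := by
    intro m
    induction m with
    | zero => simp
    | succ m ih =>
      rw [pow_succ, Submonoid.coe_mul, map_mul, ih, h, smul_mul_smul_comm, ← Circle.coe_mul,
        ← Circle.exp_add]
      congr 4
      push_cast
      ring
  obtain ⟨m, rfl | rfl⟩ := k.eq_nat_or_neg
  · simpa using hn m
  · have := congrArg star (hn m)
    rw [← map_star φ, star_smul, ← Unitary.coe_star, Unitary.star_eq_inv, ← zpow_natCast,
      ← zpow_neg] at this
    rw [this]
    congr 1
    rw [Int.cast_neg, Int.cast_natCast, neg_mul, Circle.exp_neg, Circle.coe_inv_eq_conj]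
    rfl

/-- The gauge action on the monomials. -/
theorem gauge_monomial (θ s t : ℝ) (k l : ℤ) :
    gauge θ s t (monomial θ k l) =
      Complex.exp (-Complex.I * (s * k + t * l)) • monomial θ k l := by
  have hU : gauge θ s t (U θ : algebra θ) = (Circle.exp (-s) : ℂ) • (U θ : algebra θ) :=
    Subtype.ext (conjD_opU θ s t)
  have hV : gauge θ s t (V θ : algebra θ) = (Circle.exp (-t) : ℂ) • (V θ : algebra θ) :=
    Subtype.ext (conjD_opV θ s t)
  rw [monomial, Submonoid.coe_mul, map_mul, map_zpow_of_phase _ _ _ hU, map_zpow_of_phase _ _ _ hV,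
    smul_mul_smul_comm, ← Circle.coe_mul, ← Circle.exp_add, Circle.coe_exp]
  congr 2
  push_cast
  ring

end RotationAlgebra

end

/-! Write `W` for the unitary `U^k V^l`. Since `U` and `V` commute up to the phase `exp(iθ)`,
conjugation by `W` multiplies `U` by `exp(-ilθ)` and `V` by `exp(ikθ)`. The gauge automorphism with
parameters `(lθ, -kθ)` does the same, and continuous star homomorphisms that agree on the generators
agree everywhere, so the two coincide (`conj_unitaryMonomial`). Hence `W a - a W = W (a - W* a W)`
and `W* a - a W* = W* (a - W a W*)` are the two coefficients of the formula. Normality of `W` is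
unitarity. Self-adjointness is excluded by the gauge action, which multiplies `W` by a non-real
phase for a suitable parameter while preserving adjoints (`not_isSelfAdjoint_monomial`). -/

namespace RotationAlgebra

/-- If two unitaries commute up to a phase, then so do the integer powers of the first one and the
second one, with the corresponding power of the phase. -/
theorem zpow_mul_of_phase {A : Type*} [CStarAlgebra A] (u v : unitary A) (x : ℝ)
    (h : (u * v : A) = (Circle.exp x : ℂ) • (v * u : A)) (k : ℤ) :
    (((u ^ k : unitary A) : A) * v) =
      (Circle.exp (k * x) : ℂ) • ((v : A) * ((u ^ k : unitary A) : A)) := by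
  -- The relation says that the automorphism `a ↦ v* a v` scales `u` by a phase. It therefore scales
  -- every integer power of `u`, negative ones included, and left multiplication by `v` turns this
  -- back into a commutation relation.
  have hconj : Unitary.conjStarAlgAut ℂ A (star v) (u : A) = (Circle.exp x : ℂ) • (u : A) := by
    rw [Unitary.conjStarAlgAut_apply, Unitary.coe_star, star_star, mul_assoc, h, mul_smul_comm,
      ← mul_assoc, Unitary.coe_star_mul_self, one_mul]
  have hk := congrArg ((v : A) * ·) (map_zpow_of_phase _ u x hconj k)
  simpa [Unitary.conjStarAlgAut_apply, ← mul_assoc] using hk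

/-- The monomial `U^k V^l` as a unitary element of the rotation algebra. -/
noncomputable def unitaryMonomial (θ : ℝ) (k l : ℤ) : unitary (algebra θ) := U θ ^ k * V θ ^ l

theorem V_mul_U (θ : ℝ) :
    (V θ * U θ : algebra θ) = (Circle.exp (-θ) : ℂ) • (U θ * V θ : algebra θ) := by
  rw [U_mul_V, smul_smul, ← Circle.coe_mul, ← Circle.exp_add]
  simp

/-- Only the factor `V^l` fails to commute with `U`, and each `V` moved past `U` costs `exp(-iθ)`.
-/
theorem monomial_mul_U (θ : ℝ) (k l : ℤ) :
    monomial θ k l * (U θ : algebra θ) =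
      (Circle.exp (-(l * θ)) : ℂ) • ((U θ : algebra θ) * monomial θ k l) := by
  have hU : ((U θ ^ k : unitary (algebra θ)) : algebra θ) * (U θ : algebra θ) =
      (U θ : algebra θ) * ((U θ ^ k : unitary (algebra θ)) : algebra θ) := by
    rw [← Submonoid.coe_mul, ← Submonoid.coe_mul, ← zpow_add_one, ← zpow_one_add, add_comm]
  rw [monomial, Submonoid.coe_mul, mul_assoc, zpow_mul_of_phase _ _ _ (V_mul_U θ), mul_smul_comm,
    ← mul_assoc, hU, mul_assoc, mul_neg]

theorem monomial_mul_V (θ : ℝ) (k l : ℤ) :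
    monomial θ k l * (V θ : algebra θ) =
      (Circle.exp (k * θ) : ℂ) • ((V θ : algebra θ) * monomial θ k l) := by
  have hV : ((V θ ^ l : unitary (algebra θ)) : algebra θ) * (V θ : algebra θ) =
      (V θ : algebra θ) * ((V θ ^ l : unitary (algebra θ)) : algebra θ) := by
    rw [← Submonoid.coe_mul, ← Submonoid.coe_mul, ← zpow_add_one, ← zpow_one_add, add_comm]
  rw [monomial, Submonoid.coe_mul, mul_assoc, hV, ← mul_assoc,
    zpow_mul_of_phase _ _ _ (U_mul_V θ), smul_mul_assoc, mul_assoc]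

theorem gauge_U (θ s t : ℝ) :
    gauge θ s t (U θ : algebra θ) = (Circle.exp (-s) : ℂ) • (U θ : algebra θ) :=
  Subtype.ext (conjD_opU θ s t)

theorem gauge_V (θ s t : ℝ) :
    gauge θ s t (V θ : algebra θ) = (Circle.exp (-t) : ℂ) • (V θ : algebra θ) :=
  Subtype.ext (conjD_opV θ s t)

/-- Star homomorphisms out of the rotation algebra are determined by the images of `U` and `V`. -/
theorem starAlgHom_ext {θ : ℝ} {B : Type*} [CStarAlgebra B] {φ ψ : algebra θ →⋆ₐ[ℂ] B}
    (hU : φ (U θ : algebra θ) = ψ (U θ : algebra θ))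
    (hV : φ (V θ : algebra θ) = ψ (V θ : algebra θ)) : φ = ψ := by
  -- Star homomorphisms between C*-algebras are contractive, whence the bound 1. With continuity,
  -- agreement on the dense subalgebra adjoined from the generators suffices.
  have hφ : Continuous φ := AddMonoidHomClass.continuous_of_bound φ 1 fun a => by
    simpa using NonUnitalStarAlgHom.norm_apply_le φ a
  have hψ : Continuous ψ := AddMonoidHomClass.continuous_of_bound ψ 1 fun a => by
    simpa using NonUnitalStarAlgHom.norm_apply_le ψ a
  refine StarAlgHom.ext_topologicalClosure
    (S := StarAlgebra.adjoin ℂ {(opU θ : H →L[ℂ] H), (opV θ : H →L[ℂ] H)})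
    hφ hψ ?_
  refine StarAlgHom.ext_adjoin ?_
  rintro ⟨x, hx⟩ (rfl | rfl)
  · exact hU
  · exact hV

/-- The gauge automorphism `θ̂_{l θ, -k θ}` is conjugation by the unitary `U^k V^l`. -/
theorem conj_unitaryMonomial (θ : ℝ) (k l : ℤ) (a : algebra θ) :
    Unitary.conjStarAlgAut ℂ (algebra θ) (unitaryMonomial θ k l) a =
      gauge θ (l * θ) (-k * θ) a := by
  have hW : monomial θ k l * star (monomial θ k l) = 1 :=
    Unitary.coe_mul_star_self (unitaryMonomial θ k l)
  have h : ((Unitary.conjStarAlgAut ℂ (algebra θ) (unitaryMonomial θ k l) :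
      algebra θ ≃⋆ₐ[ℂ] algebra θ) : algebra θ →⋆ₐ[ℂ] algebra θ) =
      (gauge θ (l * θ) (-k * θ) : algebra θ →⋆ₐ[ℂ] algebra θ) := by
    refine starAlgHom_ext ?_ ?_
    · change monomial θ k l * U θ * star (monomial θ k l) = gauge θ _ _ (U θ : algebra θ)
      rw [monomial_mul_U, gauge_U, smul_mul_assoc, mul_assoc, hW, mul_one]
    · change monomial θ k l * V θ * star (monomial θ k l) = gauge θ _ _ (V θ : algebra θ)
      rw [monomial_mul_V, gauge_V, smul_mul_assoc, mul_assoc, hW, mul_one, neg_mul, neg_neg]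
  exact DFunLike.congr_fun h a

theorem star_monomial_mul_monomial (θ : ℝ) (k l : ℤ) :
    star (monomial θ k l) * monomial θ k l = 1 :=
  Unitary.coe_star_mul_self (unitaryMonomial θ k l)

theorem monomial_mul_star_monomial (θ : ℝ) (k l : ℤ) :
    monomial θ k l * star (monomial θ k l) = 1 :=
  Unitary.coe_mul_star_self (unitaryMonomial θ k l)

theorem monomial_mul (θ : ℝ) (k l : ℤ) (a : algebra θ) :
    monomial θ k l * a = gauge θ (l * θ) (-k * θ) a * monomial θ k l := by
  rw [← conj_unitaryMonomial]
  change _ = monomial θ k l * a * star (monomial θ k l) * monomial θ k l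
  rw [mul_assoc _ _ (monomial θ k l), star_monomial_mul_monomial, mul_one]

/-- This is `monomial_mul` applied to the image of `a` under the inverse gauge automorphism, whose
parameters have opposite signs. -/
theorem mul_monomial (θ : ℝ) (k l : ℤ) (a : algebra θ) :
    a * monomial θ k l = monomial θ k l * gauge θ (-l * θ) (k * θ) a := by
  rw [monomial_mul, ← gauge_add]
  simp [gauge_zero]

theorem mul_star_monomial (θ : ℝ) (k l : ℤ) (a : algebra θ) :
    a * star (monomial θ k l) = star (monomial θ k l) * gauge θ (l * θ) (-k * θ) a := by
  rw [← conj_unitaryMonomial]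
  change _ = star (monomial θ k l) * (monomial θ k l * a * star (monomial θ k l))
  rw [← mul_assoc, ← mul_assoc, star_monomial_mul_monomial, one_mul]

theorem monomial_ne_zero (θ : ℝ) (k l : ℤ) : monomial θ k l ≠ 0 := by
  intro h0
  have h1 : (1 : algebra θ) = 0 := by
    rw [← star_monomial_mul_monomial θ k l, h0, mul_zero]
  have h2 : (1 : H →L[ℂ] H) = 0 := congrArg Subtype.val h1
  -- The identity and the zero operator differ on the basis vector at the origin.
  have h3 := congrArg (fun T : H →L[ℂ] H => T (lp.single 2 (0 : ℤ × ℤ) (1 : ℂ)) 0) h2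
  simp at h3

theorem not_isSelfAdjoint_monomial (θ : ℝ) {k l : ℤ} (h : (k, l) ≠ (0, 0)) :
    ¬ IsSelfAdjoint (monomial θ k l) := by
  intro hsa
  -- With the angle `π/2`, the gauge automorphism multiplies the monomial by `-i`. Such `s, t` exist
  -- because one of `k, l` is nonzero.
  obtain ⟨s, t, hst⟩ : ∃ s t : ℝ, s * k + t * l = Real.pi / 2 := by
    by_cases hk : k = 0
    · have hl : (l : ℝ) ≠ 0 := by
        intro h'
        exact h (by rw [hk, Int.cast_eq_zero.mp h'])
      exact ⟨0, Real.pi / 2 / l, by field_simp; ring⟩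
    · have hk : (k : ℝ) ≠ 0 := Int.cast_ne_zero.mpr hk
      exact ⟨Real.pi / 2 / k, 0, by field_simp; ring⟩
  have hst' : (s * k + t * l : ℂ) = Real.pi / 2 := by exact_mod_cast congrArg Complex.ofReal hst
  have hexp : Complex.exp (-Complex.I * (s * k + t * l)) = -Complex.I := by
    rw [hst', show -Complex.I * (Real.pi / 2 : ℂ) = -Real.pi / 2 * Complex.I by ring,
      Complex.exp_neg_pi_div_two_mul_I]
  have hg := gauge_monomial θ s t k l
  rw [hexp] at hg
  have hstar := congrArg star hg
  -- For self-adjoint `W`, its gauge image is self-adjoint too, so `-i W = i W`. The scalar `-2i` is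
  -- nonzero, which would force `W = 0`.
  rw [← map_star (gauge θ s t), hsa.star_eq, star_smul, hsa.star_eq, hg, ← sub_eq_zero,
    ← sub_smul] at hstar
  refine (smul_eq_zero.mp hstar).elim (fun h0 => ?_) (monomial_ne_zero θ k l)
  have := congrArg Complex.im h0
  norm_num at this

end RotationAlgebra

theorem theorem5p2 (θ : ℝ) (k₁ k₂ : ℤ) :
    ((k₁, k₂) ≠ (0, 0) →
      InnerCalculus.IsDifferentialBasis ![RotationAlgebra.monomial θ k₁ k₂]) ∧
    ∀ a : RotationAlgebra.algebra θ,
      InnerCalculus.delta ![RotationAlgebra.monomial θ k₁ k₂] a =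
        (RotationAlgebra.monomial θ k₁ k₂ *
            (a - RotationAlgebra.gauge θ (-k₂ * θ) (k₁ * θ) a)) •
          InnerCalculus.d (RotationAlgebra.algebra θ) (0 : Fin 1) +
        (star (RotationAlgebra.monomial θ k₁ k₂) *
            (a - RotationAlgebra.gauge θ (k₂ * θ) (-k₁ * θ) a)) •
          InnerCalculus.dStar (RotationAlgebra.algebra θ) (0 : Fin 1) := by
  have hcomm : Commute (RotationAlgebra.monomial θ k₁ k₂)
      (star (RotationAlgebra.monomial θ k₁ k₂)) :=
    (RotationAlgebra.monomial_mul_star_monomial θ k₁ k₂).trans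
      (RotationAlgebra.star_monomial_mul_monomial θ k₁ k₂).symm
  refine ⟨fun h => ⟨fun j => ?_, fun j k => ?_, fun j k => ?_, fun j k => ?_⟩, fun a => ?_⟩
  · simpa using RotationAlgebra.not_isSelfAdjoint_monomial θ h
  · simp
  · simpa using hcomm
  · simp
  -- Moving `W` and `W*` to the left of `a` in the commutators gives exactly the right-hand side
  -- expanded by `mul_sub`.
  · simp only [InnerCalculus.delta, Fin.sum_univ_one, Matrix.cons_val_zero, mul_sub,
      RotationAlgebra.mul_monomial, RotationAlgebra.mul_star_monomial]
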